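/- Notation. Let $n,k\ge 0$ be integers. For $X\in\mathbb{R}^{p\times q}$ and $r\ge 1$, the $r$-th multiplicative compound matrix $X_{[r]}\in\mathbb{R}^{\binom{p}{r}\times\binom{q}{r}}$ is the matrix of all $r\times r$ minors $\det X_{I,J}$, where $I\subseteq\{1,\dots,p\}$ and $J\subseteq\{1,\dots,q\}$ run over the subsets with $r$ elements. For $A\in\mathbb{R}^{n\times n}$, the $r$-th additive compound matrix is $$A^{[r]} := \left.\frac{d}{dh}\,\big(e^{Ah}\big)_{[r]}\right|_{h=0}.$$ A square matrix is Metzler if all its off-diagonal entries are nonnegative, and $X\ge 0$ means that all entries of $X$ are nonnegative (an empty matrix satisfies both conditions). For $j\ge 1$, $A\in\mathbb{R}^{n\times n}$, a column vector $b\in\mathbb{R}^n$ and a row vector $c$ with $c^{\mathsf T}\in\mathbb{R}^n$, put $$\mathcal{C}^j(A,b) := \begin{pmatrix} b & Ab & \cdots & A^{j-1}b\end{pmatrix}\in\mathbb{R}^{n\times j},\qquad \mathcal{O}^j(A,c) := \mathcal{C}^j(A^{\mathsf T},c^{\mathsf T})^{\mathsf T}\in\mathbb{R}^{j\times n}.$$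 Theorem. Let $A\in\mathbb{R}^{n\times n}$ and $b,c^{\mathsf T}\in\mathbb{R}^n$ be such that $A^{[j]}$ is Metzler for all $1\le j\le k$. Then: (i) $\mathcal{C}^j(A,b)_{[j]}\ge 0$ for all $1\le j\le k$ if and only if there exists $\varepsilon>0$ such that $\mathcal{C}^j(e^{Ah},b)_{[j]}\ge 0$ for all $1\le j\le k$ and all $h\in(0,\varepsilon)$. (ii) $\mathcal{O}^j(A,c)_{[j]}\ge 0$ for all $1\le j\le k$ if and only if there exists $\varepsilon>0$ such that $\mathcal{O}^j(e^{Ah},c)_{[j]}\ge 0$ for all $1\le j\le k$ and all $h\in(0,\varepsilon)$. -/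

import Mathlib

noncomputable section

/-- Entrywise nonnegativity of a real matrix, written `X ≥ 0`. -/
def EntrywiseNonneg {m p : Type*} (X : Matrix m p ℝ) : Prop :=
  ∀ i j, 0 ≤ X i j

/-- A square real matrix is Metzler if its off-diagonal entries are nonnegative. -/
def IsMetzler {m : Type*} (X : Matrix m m ℝ) : Prop :=
  ∀ i j, i ≠ j → 0 ≤ X i j

/-- The `r`-th multiplicative compound matrix of `X ∈ ℝ^{n × m}`: the matrix of all `r`-minors.
Rows and columns are indexed by strictly increasing `r`-tuples, that is, by the `r`-element subsets
of `{1, …, n}` and of `{1, …, m}`. -/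
def multCompound {n m : ℕ} (X : Matrix (Fin n) (Fin m) ℝ) (r : ℕ) :
    Matrix (Fin r ↪o Fin n) (Fin r ↪o Fin m) ℝ :=
  Matrix.of fun I J => (X.submatrix I J).det

/-- The `r`-th additive compound matrix of `A ∈ ℝ^{n × n}`: the (entrywise) derivative at `h = 0` of
the `r`-th multiplicative compound matrix of `exp (h A)`. -/
def addCompound {n : ℕ} (A : Matrix (Fin n) (Fin n) ℝ) (r : ℕ) :
    Matrix (Fin r ↪o Fin n) (Fin r ↪o Fin n) ℝ :=
  Matrix.of fun I J => deriv (fun h : ℝ => multCompound (NormedSpace.exp (h • A)) r I J) 0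

open scoped Matrix.Norms.Operator in
/-- The derivative that defines the additive compound matrix exists. -/
theorem hasDerivAt_multCompound_exp {n : ℕ} (A : Matrix (Fin n) (Fin n) ℝ) (r : ℕ)
    (I J : Fin r ↪o Fin n) :
    HasDerivAt (fun h : ℝ => multCompound (NormedSpace.exp (h • A)) r I J)
      (addCompound A r I J) 0 := by
  have hexp : Differentiable ℝ fun h : ℝ => NormedSpace.exp (h • A) :=
    fun t => (hasDerivAt_exp_smul_const (𝕂 := ℝ) A t).differentiableAt
  have hent : ∀ i j, Differentiable ℝ fun h : ℝ => NormedSpace.exp (h • A) i j := fun i j =>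
    ((LinearMap.toContinuousLinearMap (Matrix.entryLinearMap ℝ ℝ i j)).differentiable).comp hexp
  have hdet : Differentiable ℝ fun h : ℝ => multCompound (NormedSpace.exp (h • A)) r I J := by
    simp only [multCompound, Matrix.of_apply, Matrix.det_apply, Matrix.submatrix_apply]
    fun_prop
  exact (hdet 0).hasDerivAt

/-- The truncated controllability matrix `(b  A b  …  A^{j-1} b) ∈ ℝ^{n × j}`. -/
def conMat {n : ℕ} (j : ℕ) (A : Matrix (Fin n) (Fin n) ℝ) (b : Fin n → ℝ) :
    Matrix (Fin n) (Fin j) ℝ :=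
  Matrix.of fun i t => ((A ^ (t : ℕ)).mulVec b) i

/-- The truncated observability matrix, with rows `c, c A, …, c A^{j-1}`, for the row vector `c`. -/
def obsMat {n : ℕ} (j : ℕ) (A : Matrix (Fin n) (Fin n) ℝ) (c : Fin n → ℝ) :
    Matrix (Fin j) (Fin n) ℝ :=
  (conMat j A.transpose c).transpose

end

noncomputable section

open scoped ContDiff

/-! For rows `I`, let `f a t` be the `I a`-th coordinate of `e^{tA} b`. The sampled minor on rows
`I` is the determinant of the values `f a (l h)`, while the Wronskian of `f` is the `I`-th
coordinate of `exp (t A^{[r]})` applied to the vector of `r`-minors of `C^r(A,b)` (Cauchy–Binet and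
`multCompound_exp`). As `A^{[r]}` is Metzler and that vector nonnegative, each such Wronskian is
positive for all `t > 0` or identically zero. A Pólya-type induction,
`det_values_nonneg_of_wronskian` (divide by the first function, differentiate), turns this into
nonnegative determinants of values at increasing points, for every `h > 0`.

Conversely, `(e^{hA} - 1) / h` tends to `A` as `h → 0+`, and the minors of `C^j(Y,b)` are unchanged
when `1` is added to `Y` and gain a positive factor when `Y` is scaled by a positive number. Part
(ii) is part (i) for the transpose. -/

/-! ### Cauchy–Binet and multiplicative compounds -/

/-- Row expansion of the determinant of a product of rectangular matrices. -/
theorem det_mul_eq_sum_functions {r n : ℕ} (M : Matrix (Fin r) (Fin n) ℝ)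
    (N : Matrix (Fin n) (Fin r) ℝ) :
    (M * N).det = ∑ p : Fin r → Fin n, (∏ i, M i (p i)) * (N.submatrix p id).det := by
  classical
  have h : (M * N) = Matrix.of fun i => ∑ k, M i k • N k := by
    ext i j
    simp [Matrix.mul_apply, Finset.sum_apply]
  have h2 : (M * N).det = Matrix.detRowAlternating.toMultilinearMap
      (fun i => ∑ k, M i k • N k) := by
    rw [h]; rfl
  rw [h2, MultilinearMap.map_sum]
  refine Finset.sum_congr rfl fun p _ => ?_
  rw [MultilinearMap.map_smul_univ (Matrix.detRowAlternating.toMultilinearMap)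
    (fun i => M i (p i)) (fun i => N (p i))]
  rfl

/-- The Cauchy–Binet formula. -/
theorem det_mul_cauchyBinet {r n : ℕ} (M : Matrix (Fin r) (Fin n) ℝ)
    (N : Matrix (Fin n) (Fin r) ℝ) :
    (M * N).det = ∑ J : Fin r ↪o Fin n, (M.submatrix id J).det * (N.submatrix J id).det := by
  classical
  rw [det_mul_eq_sum_functions]
  have hR : ∀ J : Fin r ↪o Fin n, (M.submatrix id J).det * (N.submatrix J id).det =
      ∑ σ : Equiv.Perm (Fin r), (∏ i, M i (J (σ i))) * (N.submatrix (J ∘ σ) id).det := by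
    intro J
    rw [← Matrix.det_transpose, Matrix.det_apply', Finset.sum_mul]
    refine Finset.sum_congr rfl fun σ _ => ?_
    have : (N.submatrix (J ∘ σ) id) = (N.submatrix J id).submatrix σ id := rfl
    rw [this, Matrix.det_permute]
    simp only [Matrix.transpose_apply, Matrix.submatrix_apply, id]
    ring
  simp_rw [hR]
  rw [← Fintype.sum_prod_type'
    (f := fun (J : Fin r ↪o Fin n) (σ : Equiv.Perm (Fin r)) =>
      (∏ i, M i (J (σ i))) * (N.submatrix (J ∘ σ) id).det)]
  symm
  -- Sorting writes each injective `p` uniquely as `J ∘ σ`; a non-injective `p` repeats a row and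
  -- contributes zero.
  refine Finset.sum_of_injOn (fun x : (Fin r ↪o Fin n) × Equiv.Perm (Fin r) => x.1 ∘ x.2)
    ?_ (fun _ _ => Finset.mem_coe.2 (Finset.mem_univ _)) ?_ (fun _ _ => rfl)
  · rintro ⟨J, σ⟩ - ⟨J', σ'⟩ - h
    simp only at h
    have hJ : J = J' := by
      apply OrderEmbedding.range_inj.1
      have := congrArg Set.range h
      simpa [Set.range_comp] using this
    subst hJ
    have : σ = σ' := Equiv.ext fun i => J.injective (congrFun h i)
    rw [this]
  · intro p _ hp
    have hni : ¬ Function.Injective p := by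
      intro hinj
      apply hp
      have hs : StrictMono (p ∘ Tuple.sort p) :=
        (Tuple.monotone_sort p).strictMono_of_injective (hinj.comp (Tuple.sort p).injective)
      refine ⟨(OrderEmbedding.ofStrictMono _ hs, (Tuple.sort p)⁻¹), by simp, ?_⟩
      funext i
      simp
    obtain ⟨i, j, hij, hne⟩ : ∃ i j, p i = p j ∧ i ≠ j := by
      simpa [Function.Injective] using hni
    rw [Matrix.det_zero_of_row_eq hne, mul_zero]
    funext l
    simp [hij]

theorem multCompound_mul {n m q : ℕ} (X : Matrix (Fin n) (Fin m) ℝ) (Y : Matrix (Fin m) (Fin q) ℝ)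
    (r : ℕ) : multCompound (X * Y) r = multCompound X r * multCompound Y r := by
  ext I J
  simp only [multCompound, Matrix.mul_apply, Matrix.of_apply]
  rw [Matrix.submatrix_mul X Y I id J Function.bijective_id, det_mul_cauchyBinet]
  rfl

theorem multCompound_one {n : ℕ} (r : ℕ) :
    multCompound (1 : Matrix (Fin n) (Fin n) ℝ) r = 1 := by
  classical
  ext I J
  simp only [multCompound, Matrix.of_apply]
  by_cases h : I = J
  · subst h
    rw [Matrix.submatrix_one _ I.injective]; simp
  · rw [Matrix.one_apply_ne h]
    have hr : ∃ i, ∀ j, I i ≠ J j := by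
      by_contra! hc
      apply h
      apply OrderEmbedding.range_inj.1
      have hsub : Set.range I ⊆ Set.range J := by
        rintro _ ⟨i, rfl⟩
        obtain ⟨j, hj⟩ := hc i
        exact ⟨j, hj.symm⟩
      refine Set.eq_of_subset_of_ncard_le hsub ?_ (Set.finite_range _)
      rw [← Nat.card_coe_set_eq, ← Nat.card_coe_set_eq,
        Nat.card_range_of_injective I.injective, Nat.card_range_of_injective J.injective]
    obtain ⟨i, hi⟩ := hr
    exact Matrix.det_eq_zero_of_row_eq_zero i fun j => by simp [Matrix.one_apply_ne (hi j)]

theorem multCompound_transpose {n m : ℕ} (X : Matrix (Fin n) (Fin m) ℝ) (r : ℕ) :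
    multCompound X.transpose r = (multCompound X r).transpose := by
  ext I J
  simp only [multCompound, Matrix.of_apply, Matrix.transpose_apply]
  rw [← Matrix.det_transpose]
  rfl

theorem addCompound_transpose {n : ℕ} (A : Matrix (Fin n) (Fin n) ℝ) (r : ℕ) :
    addCompound A.transpose r = (addCompound A r).transpose := by
  ext I J
  simp only [addCompound, Matrix.of_apply, Matrix.transpose_apply, ← Matrix.transpose_smul,
    Matrix.exp_transpose, multCompound_transpose]

/-! ### Additive compounds as generators -/

theorem exp_add_smul {ι : Type*} [Fintype ι] [DecidableEq ι] (B : Matrix ι ι ℝ) (s t : ℝ) :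
    NormedSpace.exp ((s + t) • B) = NormedSpace.exp (s • B) * NormedSpace.exp (t • B) := by
  rw [add_smul, Matrix.exp_add_of_commute]
  exact (Commute.refl B).smul_left s |>.smul_right t

open scoped Matrix.Norms.Operator in
theorem hasDerivAt_exp_smul_apply {ι : Type*} [Fintype ι] [DecidableEq ι] (B : Matrix ι ι ℝ)
    (t : ℝ) (i j : ι) :
    HasDerivAt (fun t : ℝ => NormedSpace.exp (t • B) i j) ((NormedSpace.exp (t • B) * B) i j) t :=
  ((LinearMap.toContinuousLinearMap (Matrix.entryLinearMap ℝ ℝ i j)).hasFDerivAt).comp_hasDerivAt t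
    (hasDerivAt_exp_smul_const (𝕂 := ℝ) B t)

theorem hasDerivAt_multCompound_exp_smul {n : ℕ} (A : Matrix (Fin n) (Fin n) ℝ) (r : ℕ) (t : ℝ)
    (I J : Fin r ↪o Fin n) :
    HasDerivAt (fun h : ℝ => multCompound (NormedSpace.exp (h • A)) r I J)
      ((addCompound A r * multCompound (NormedSpace.exp (t • A)) r) I J) t := by
  have h : (fun h : ℝ => multCompound (NormedSpace.exp (h • A)) r I J) = fun h : ℝ =>
      ∑ K, multCompound (NormedSpace.exp ((h - t) • A)) r I K *
        multCompound (NormedSpace.exp (t • A)) r K J := by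
    funext s
    rw [← Matrix.mul_apply, ← multCompound_mul, ← exp_add_smul, sub_add_cancel]
  rw [h, Matrix.mul_apply]
  refine HasDerivAt.fun_sum fun K _ => HasDerivAt.mul_const ?_ _
  have h0 : HasDerivAt (fun h : ℝ => multCompound (NormedSpace.exp (h • A)) r I K)
      (addCompound A r I K) (t - t) := by
    rw [sub_self]; exact hasDerivAt_multCompound_exp A r I K
  exact h0.comp_sub_const t t

/-- Both sides solve `M' = A^{[r]} M`, `M 0 = 1`: multiplying the left side by `exp (-t A^{[r]})`
gives a matrix with zero derivative. -/
theorem multCompound_exp {n : ℕ} (A : Matrix (Fin n) (Fin n) ℝ) (r : ℕ) (t : ℝ) :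
    multCompound (NormedSpace.exp (t • A)) r = NormedSpace.exp (t • addCompound A r) := by
  classical
  set B := addCompound A r with hB
  set M : ℝ → Matrix (Fin r ↪o Fin n) (Fin r ↪o Fin n) ℝ :=
    fun t => multCompound (NormedSpace.exp (t • A)) r with hM
  have hN : ∀ t, NormedSpace.exp (t • -B) * M t = 1 := by
    intro t
    ext I J
    have hd : ∀ s, HasDerivAt (fun s => ∑ K, NormedSpace.exp (s • -B) I K * M s K J) 0 s := by
      intro s
      have := HasDerivAt.fun_sum (u := Finset.univ) fun K _ =>
        (hasDerivAt_exp_smul_apply (-B) s I K).mul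
          (hasDerivAt_multCompound_exp_smul A r s K J)
      refine this.congr_deriv ?_
      rw [Finset.sum_add_distrib, ← Matrix.mul_apply, ← Matrix.mul_apply, ← hB]
      simp [Matrix.mul_assoc]
    have hc : (NormedSpace.exp (t • -B) * M t) I J = (NormedSpace.exp ((0 : ℝ) • -B) * M 0) I J :=
      is_const_of_deriv_eq_zero (fun s => (hd s).differentiableAt) (fun s => (hd s).deriv) t 0
    rw [hc]
    simp [hM, multCompound_one]
  have h1 : NormedSpace.exp (t • B) * NormedSpace.exp (t • -B) = 1 := by
    rw [smul_neg, ← neg_smul, ← exp_add_smul]; simp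
  calc M t = (NormedSpace.exp (t • B) * NormedSpace.exp (t • -B)) * M t := by rw [h1, one_mul]
    _ = _ := by rw [mul_assoc, hN, mul_one]

/-! ### Positivity of Metzler flows -/

open scoped Matrix.Norms.Operator in
theorem hasSum_exp_smul_mulVec {ι : Type*} [Fintype ι] [DecidableEq ι] (P : Matrix ι ι ℝ)
    (v : ι → ℝ) (t : ℝ) (i : ι) :
    HasSum (fun m : ℕ => ((m.factorial : ℝ)⁻¹ * t ^ m) * ((P ^ m).mulVec v) i)
      ((NormedSpace.exp (t • P)).mulVec v i) := by
  have h := NormedSpace.exp_series_hasSum_exp' (𝕂 := ℝ) (t • P)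
  let L : Matrix ι ι ℝ →ₗ[ℝ] ℝ := LinearMap.proj i ∘ₗ (Matrix.mulVecBilin ℝ ℝ).flip v
  have h2 := (LinearMap.toContinuousLinearMap L).hasSum h
  have hL : ∀ M, L M = M.mulVec v i := fun _ => rfl
  have hterm : (fun m : ℕ => ((m.factorial : ℝ)⁻¹ * t ^ m) * ((P ^ m).mulVec v) i) =
      fun m : ℕ => L (((m.factorial : ℝ)⁻¹) • (t • P) ^ m) := by
    funext m
    rw [hL]
    simp [smul_pow, Matrix.smul_mulVec, mul_assoc]
  rw [hterm]
  exact h2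

/-- A coordinate of the trajectory of a Metzler system started at a nonnegative vector either is
positive at all positive times or vanishes identically. -/
theorem IsMetzler.exp_mulVec_pos_or_eq_zero {ι : Type*} [Fintype ι] [DecidableEq ι]
    {B : Matrix ι ι ℝ} (hB : IsMetzler B) {v : ι → ℝ} (hv : ∀ i, 0 ≤ v i) (i : ι) :
    (∀ t : ℝ, 0 < t → 0 < (NormedSpace.exp (t • B)).mulVec v i) ∨
      (∀ t : ℝ, (NormedSpace.exp (t • B)).mulVec v i = 0) := by
  -- A shift large enough to make `P = B + c` entrywise nonnegative. Then `e^{tB} v = e^{-tc} e^{tP}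
  -- v`, and the power series of `e^{tP} v` has nonnegative terms for `t > 0`: one nonzero term
  -- forces positivity.
  set c : ℝ := ∑ i, |B i i| with hc
  set P : Matrix ι ι ℝ := B + c • (1 : Matrix ι ι ℝ) with hP
  have hP0 : ∀ i j, 0 ≤ P i j := by
    intro i j
    by_cases hij : i = j
    · subst hij
      have h1 : |B i i| ≤ c := Finset.single_le_sum (f := fun i => |B i i|)
        (fun _ _ => abs_nonneg _) (Finset.mem_univ i)
      have h2 := neg_abs_le (B i i)
      simp only [hP, Matrix.add_apply, Matrix.smul_apply, Matrix.one_apply_eq, smul_eq_mul]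
      linarith
    · simpa [hP, Matrix.one_apply_ne hij] using hB i j hij
  have hPv : ∀ (m : ℕ) (i : ι), 0 ≤ (P ^ m).mulVec v i := by
    intro m
    induction m with
    | zero => simpa using hv
    | succ m ih =>
      intro i
      rw [pow_succ', ← Matrix.mulVec_mulVec]
      exact Finset.sum_nonneg fun j _ => mul_nonneg (hP0 i j) (ih j)
  have hexp : ∀ t : ℝ, (NormedSpace.exp (t • B)).mulVec v i =
      Real.exp (-(t * c)) * (NormedSpace.exp (t • P)).mulVec v i := by
    intro t
    have h1 : t • B = Matrix.diagonal (fun _ : ι => -(t * c)) + t • P := by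
      ext i j
      by_cases hij : i = j
      · subst hij; simp [hP]
      · simp [hP, hij]
    have h2 : NormedSpace.exp (fun _ : ι => -(t * c)) = fun _ => Real.exp (-(t * c)) := by
      ext j
      rw [Pi.coe_exp, Real.exp_eq_exp_ℝ]
    have h3 : Matrix.diagonal (fun _ : ι => Real.exp (-(t * c))) =
        Real.exp (-(t * c)) • (1 : Matrix ι ι ℝ) := by
      ext i j
      by_cases hij : i = j
      · subst hij; simp
      · simp [hij]
    rw [h1, Matrix.exp_add_of_commute, Matrix.exp_diagonal, h2, h3]
    · simp [Matrix.smul_mulVec]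
    · have : Matrix.diagonal (fun _ : ι => -(t * c)) = (-(t * c)) • (1 : Matrix ι ι ℝ) := by
        ext i j
        by_cases hij : i = j
        · subst hij; simp
        · simp [hij]
      rw [this]
      exact (Commute.one_left _).smul_left _
  by_cases h : ∃ m, (P ^ m).mulVec v i ≠ 0
  · left
    obtain ⟨m, hm⟩ := h
    intro t ht
    rw [hexp]
    refine mul_pos (Real.exp_pos _) ?_
    have hs := hasSum_exp_smul_mulVec P v t i
    rw [← hs.tsum_eq]
    refine hs.summable.tsum_pos (fun k => ?_) m ?_
    · exact mul_nonneg (by positivity) (hPv k i)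
    · exact mul_pos (by positivity) (lt_of_le_of_ne (hPv m i) hm.symm)
  · right
    push Not at h
    intro t
    have hs := hasSum_exp_smul_mulVec P v t i
    simp only [h, mul_zero] at hs
    rw [hexp, hs.unique hasSum_zero, mul_zero]

/-! ### Wronskians and determinants of values -/

open Set in
/-- If all determinants of derivatives at interlacing points are nonnegative, so is the determinant
of the increments. -/
theorem det_increments_nonneg {r : ℕ} {U : Set ℝ} (hU : U.OrdConnected) {g : Fin r → ℝ → ℝ}
    (hg : ∀ a, ∀ x ∈ U, DifferentiableAt ℝ (g a) x) {l u : Fin r → ℝ} (hl : ∀ b, l b ∈ U)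
    (hu : ∀ b, u b ∈ U) (hlu : ∀ b, l b < u b)
    (hdet : ∀ s : Fin r → ℝ, (∀ b, s b ∈ Ioo (l b) (u b)) →
      0 ≤ (Matrix.of fun a b => deriv (g a) (s b)).det) :
    0 ≤ (Matrix.of fun a b => g a (u b) - g a (l b)).det := by
  classical
  -- Columns indexed by `S` have already been changed from derivatives to increments. Along one more
  -- column the determinant has nonnegative derivative, hence is monotone.
  have key : ∀ S : Finset (Fin r), ∀ s : Fin r → ℝ, (∀ b, s b ∈ Ioo (l b) (u b)) →
      0 ≤ (Matrix.of fun a b =>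
        if b ∈ S then g a (u b) - g a (l b) else deriv (g a) (s b)).det := by
    intro S
    induction S using Finset.induction_on with
    | empty => intro s hs; simpa using hdet s hs
    | insert b₀ S hb₀ ih =>
      intro s hs
      set N : Matrix (Fin r) (Fin r) ℝ := Matrix.of fun a b =>
        if b ∈ S then g a (u b) - g a (l b) else deriv (g a) (s b) with hN
      let L : (Fin r → ℝ) →L[ℝ] ℝ :=
        LinearMap.toContinuousLinearMap (LinearMap.proj b₀ ∘ₗ N.cramer)
      have hL : ∀ w, L w = (N.updateCol b₀ w).det := fun w => Matrix.cramer_apply N w b₀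
      have hsub : Icc (l b₀) (u b₀) ⊆ U := hU.out (hl b₀) (hu b₀)
      have hd : ∀ x ∈ U, HasDerivAt (fun x => L fun a => g a x) (L fun a => deriv (g a) x) x :=
        fun x hx => L.hasFDerivAt.comp_hasDerivAt x
          (hasDerivAt_pi.2 fun a => (hg a x hx).hasDerivAt)
      have hmono : MonotoneOn (fun x => L fun a => g a x) (Icc (l b₀) (u b₀)) := by
        refine monotoneOn_of_deriv_nonneg (convex_Icc _ _)
          (fun x hx => (hd x (hsub hx)).continuousAt.continuousWithinAt)
          (fun x hx => (hd x (hsub (interior_subset hx))).differentiableAt.differentiableWithinAt)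
          fun x hx => ?_
        rw [(hd x (hsub (interior_subset hx))).deriv, hL]
        rw [interior_Icc] at hx
        have hi := ih (Function.update s b₀ x) fun b => by
          by_cases hb : b = b₀
          · subst hb; simpa using hx
          · simpa [hb] using hs b
        convert hi using 2
        ext a b
        by_cases hb : b = b₀
        · subst hb; simp [hb₀]
        · simp [hN, hb]
      have h := hmono (left_mem_Icc.2 (hlu b₀).le) (right_mem_Icc.2 (hlu b₀).le) (hlu b₀).le
      have h' := sub_nonneg.2 h
      simp only [← map_sub] at h'
      rw [hL] at h'
      have he : (Matrix.of fun a b =>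
          if b ∈ insert b₀ S then g a (u b) - g a (l b) else deriv (g a) (s b)) =
          N.updateCol b₀ ((fun a => g a (u b₀)) - fun a => g a (l b₀)) := by
        ext a b
        by_cases hb : b = b₀
        · subst hb; simp
        · simp [hN, hb]
      rwa [he]
  simpa using key Finset.univ (fun b => (l b + u b) / 2)
    fun b => ⟨by linarith [hlu b], by linarith [hlu b]⟩

theorem det_eq_submatrix_of_row_zero {r : ℕ} {M : Matrix (Fin (r + 1)) (Fin (r + 1)) ℝ}
    (h0 : M 0 0 = 1) (h : ∀ b : Fin r, M 0 b.succ = 0) :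
    M.det = (M.submatrix Fin.succ Fin.succ).det := by
  rw [Matrix.det_succ_row_zero, Fin.sum_univ_succ]
  simp [h0, h]

/-- The determinant of values of functions the first of which is constantly one. -/
theorem det_of_first_row_one {r : ℕ} (M : Matrix (Fin (r + 1)) (Fin (r + 1)) ℝ)
    (h : ∀ b, M 0 b = 1) :
    M.det = (Matrix.of fun a b : Fin r => M a.succ b.succ - M a.succ b.castSucc).det := by
  -- Subtracting the preceding column from each column turns the first row into `(1, 0, …, 0)`.
  set B : Matrix (Fin (r + 1)) (Fin (r + 1)) ℝ :=
    Matrix.of fun a => Fin.cons (M a 0) fun b : Fin r => M a b.succ - M a b.castSucc with hB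
  rw [Matrix.det_eq_of_forall_col_eq_smul_add_pred (B := B) (c := fun _ => 1) (by simp [hB])
    (by simp [hB]), det_eq_submatrix_of_row_zero (by simp [hB, h]) (by simp [hB, h])]
  congr 1

/-- The Wronskian of a finite family of functions. -/
def wronskian {r : ℕ} (f : Fin r → ℝ → ℝ) (t : ℝ) : ℝ :=
  (Matrix.of fun a m : Fin r => iteratedDeriv m (f a) t).det

/-- By the Leibniz rule, multiplying by `φ` acts on the Wronskian matrix as an upper triangular
factor with diagonal `φ t`. -/
theorem wronskian_mul {r : ℕ} {φ : ℝ → ℝ} {u f : Fin r → ℝ → ℝ} {t : ℝ}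
    (hφ : ContDiffAt ℝ ∞ φ t) (hu : ∀ a, ContDiffAt ℝ ∞ (u a) t)
    (hf : ∀ a, f a =ᶠ[nhds t] u a * φ) :
    wronskian f t = φ t ^ r * wronskian u t := by
  set T : Matrix (Fin r) (Fin r) ℝ := Matrix.of fun i m =>
    ((m : ℕ).choose i : ℝ) * iteratedDeriv ((m : ℕ) - i) φ t with hT
  have h : (Matrix.of fun a m : Fin r => iteratedDeriv m (f a) t) =
      (Matrix.of fun a m : Fin r => iteratedDeriv m (u a) t) * T := by
    ext a m
    have hm : ((m : ℕ) : WithTop ℕ∞) ≤ ∞ := by exact_mod_cast le_top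
    rw [Matrix.of_apply, (hf a).iteratedDeriv_eq, iteratedDeriv_mul ((hu a).of_le hm)
      (hφ.of_le hm), Matrix.mul_apply]
    simp only [hT, Matrix.of_apply]
    rw [Fin.sum_univ_eq_sum_range (fun i => iteratedDeriv i (u a) t *
      (((m : ℕ).choose i : ℝ) * iteratedDeriv ((m : ℕ) - i) φ t)) r]
    rw [← Finset.sum_subset (Finset.range_subset_range.2 m.isLt)]
    · exact Finset.sum_congr rfl fun i _ => by ring
    · intro i _ hi
      rw [Nat.choose_eq_zero_of_lt (by simpa using hi)]
      simp
  have hTdet : T.det = φ t ^ r := by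
    rw [Matrix.det_of_isUpperTriangular]
    · simp [hT]
    · intro i j hij
      simp only [hT, Matrix.of_apply]
      rw [Nat.choose_eq_zero_of_lt (by exact_mod_cast hij)]
      simp
  rw [wronskian, h, Matrix.det_mul, hTdet, wronskian, mul_comm]

theorem wronskian_of_first_one {r : ℕ} {u : Fin (r + 1) → ℝ → ℝ} {t : ℝ}
    (hu : u 0 =ᶠ[nhds t] fun _ => 1) :
    wronskian u t = wronskian (fun a : Fin r => deriv (u a.succ)) t := by
  rw [wronskian, det_eq_submatrix_of_row_zero]
  · rw [wronskian]
    congr 1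
    ext a m
    simp [iteratedDeriv_succ']
  · simpa using hu.eq_of_nhds
  · intro b
    rw [Matrix.of_apply, hu.iteratedDeriv_eq]
    simp [iteratedDeriv_const]

/-- If every initial Wronskian of a family of smooth functions is positive or identically zero, the
determinants of values at increasing points are nonnegative. -/
theorem det_values_nonneg_of_wronskian {U : Set ℝ} (hU : IsOpen U) (hc : U.OrdConnected) :
    ∀ {r : ℕ} {f : Fin r → ℝ → ℝ}, (∀ a, ContDiffOn ℝ ∞ (f a) U) →
      (∀ q (hq : q ≤ r), 0 < q →
        (∀ t ∈ U, 0 < wronskian (fun a : Fin q => f (a.castLE hq)) t) ∨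
        (∀ t ∈ U, wronskian (fun a : Fin q => f (a.castLE hq)) t = 0)) →
      ∀ {t : Fin r → ℝ}, (∀ b, t b ∈ U) → StrictMono t →
        0 ≤ (Matrix.of fun a b => f a (t b)).det
  | 0, _, _, _, _, _, _ => by simp
  | r + 1, f, hf, hW, t, htU, ht => by
    have hW1 : ∀ x, wronskian (fun a : Fin 1 => f (a.castLE (Nat.succ_le_succ r.zero_le))) x =
        f 0 x := by
      intro x; simp [wronskian]
    have h1 := hW 1 (Nat.succ_le_succ r.zero_le) one_pos
    simp only [hW1] at h1
    rcases h1 with h1 | h1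
    · set u : Fin (r + 1) → ℝ → ℝ := fun a => f a / f 0 with hu
      have hus : ∀ a, ContDiffOn ℝ ∞ (u a) U := fun a =>
        (hf a).div (hf 0) fun x hx => (h1 x hx).ne'
      have hfu : ∀ a, ∀ x ∈ U, f a x = u a x * f 0 x := fun a x hx => by
        simp [hu, div_mul_cancel₀ _ (h1 x hx).ne']
      have hu1 : ∀ x ∈ U, u 0 x = 1 := fun x hx => by simp [hu, div_self (h1 x hx).ne']
      have hF : ∀ a : Fin r, ContDiffOn ℝ ∞ (deriv (u a.succ)) U := fun a =>
        (hus a.succ).deriv_of_isOpen hU (by simp)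
      have hWF : ∀ q (hq : q ≤ r), ∀ x ∈ U,
          wronskian (fun a : Fin (q + 1) => f (a.castLE (Nat.succ_le_succ hq))) x =
            f 0 x ^ (q + 1) * wronskian (fun a : Fin q => deriv (u (a.castLE hq).succ)) x := by
        intro q hq x hx
        have hxU := hU.mem_nhds hx
        rw [wronskian_mul (φ := f 0) (u := fun a => u (a.castLE (Nat.succ_le_succ hq)))
          ((hf 0).contDiffAt hxU) (fun a => (hus _).contDiffAt hxU)
          (fun a => Filter.eventually_of_mem hxU fun y hy => hfu _ y hy), wronskian_of_first_one]
        · rfl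
        · exact Filter.eventually_of_mem hxU hu1
      have hdet : (Matrix.of fun a b => f a (t b)).det =
          (∏ b, f 0 (t b)) * (Matrix.of fun a b => u a (t b)).det := by
        rw [← Matrix.det_mul_row]
        congr 1
        ext a b
        simp [hfu a _ (htU b), mul_comm]
      rw [hdet]
      refine mul_nonneg (Finset.prod_nonneg fun b _ => (h1 _ (htU b)).le) ?_
      rw [det_of_first_row_one _ fun b => by simpa using hu1 _ (htU b)]
      refine det_increments_nonneg (g := fun a : Fin r => u a.succ) (l := fun b => t b.castSucc)
        (u := fun b => t b.succ) hc
        (fun a x hx => ((hus _).contDiffAt (hU.mem_nhds hx)).differentiableAt (by simp))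
        (fun b => htU _) (fun b => htU _) (fun b => ht b.castSucc_lt_succ) fun s hs => ?_
      -- The `s b` lie in consecutive gaps of `t`, so they increase, and the derivatives inherit the
      -- dichotomy through `hWF`.
      refine det_values_nonneg_of_wronskian hU hc (f := fun a => deriv (u a.succ)) hF
        (fun q hq hq0 => ?_) (fun b => hc.out (htU _) (htU _) ⟨(hs b).1.le, (hs b).2.le⟩)
        (fun a b hab => (hs a).2.trans ((ht.monotone ?_).trans_lt (hs b).1))
      · refine (hW (q + 1) (Nat.succ_le_succ hq) q.succ_pos).imp (fun h x hx => ?_)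
          fun h x hx => ?_
        · have := h x hx
          rw [hWF q hq x hx] at this
          exact (pos_iff_pos_of_mul_pos this).1 (pow_pos (h1 x hx) _)
        · have := h x hx
          rw [hWF q hq x hx] at this
          exact (mul_eq_zero.1 this).resolve_left (pow_pos (h1 x hx) _).ne'
      · exact Fin.succ_le_castSucc_iff.2 hab
    · exact (Matrix.det_eq_zero_of_row_eq_zero 0 fun b => by simpa using h1 _ (htU b)).ge

/-! ### Sampling the trajectory -/

theorem OrderEmbedding.fin_eq_refl {j : ℕ} (K : Fin j ↪o Fin j) : K = RelEmbedding.refl _ := by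
  apply OrderEmbedding.range_inj.1
  rw [(Finite.injective_iff_surjective.1 K.injective).range_eq]
  exact (Set.range_id (α := Fin j)).symm

theorem exp_smul_pow {n : ℕ} (A : Matrix (Fin n) (Fin n) ℝ) (h : ℝ) (l : ℕ) :
    NormedSpace.exp (h • A) ^ l = NormedSpace.exp ((l * h) • A) := by
  rw [← Matrix.exp_nsmul, mul_smul, Nat.cast_smul_eq_nsmul]

theorem hasDerivAt_exp_smul_mulVec {n : ℕ} (A : Matrix (Fin n) (Fin n) ℝ) (w : Fin n → ℝ)
    (i : Fin n) (t : ℝ) :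
    HasDerivAt (fun t : ℝ => (NormedSpace.exp (t • A)).mulVec w i)
      ((NormedSpace.exp (t • A)).mulVec (A.mulVec w) i) t := by
  rw [Matrix.mulVec_mulVec]
  simp only [Matrix.mulVec, dotProduct]
  exact HasDerivAt.fun_sum fun j _ => (hasDerivAt_exp_smul_apply A t i j).mul_const _

theorem iteratedDeriv_exp_smul_mulVec {n : ℕ} (A : Matrix (Fin n) (Fin n) ℝ) (i : Fin n) (m : ℕ) :
    ∀ w : Fin n → ℝ, iteratedDeriv m (fun t : ℝ => (NormedSpace.exp (t • A)).mulVec w i) =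
      fun t : ℝ => (NormedSpace.exp (t • A)).mulVec ((A ^ m).mulVec w) i := by
  induction m with
  | zero => intro w; simp
  | succ m ih =>
    intro w
    rw [iteratedDeriv_succ', funext fun t => (hasDerivAt_exp_smul_mulVec A w i t).deriv, ih,
      Matrix.mulVec_mulVec, pow_succ]

theorem contDiff_exp_smul_mulVec {n : ℕ} (A : Matrix (Fin n) (Fin n) ℝ) (w : Fin n → ℝ)
    (i : Fin n) : ContDiff ℝ ∞ fun t : ℝ => (NormedSpace.exp (t • A)).mulVec w i := by
  refine contDiff_of_differentiable_iteratedDeriv fun m _ => ?_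
  rw [iteratedDeriv_exp_smul_mulVec]
  exact fun t => (hasDerivAt_exp_smul_mulVec A _ i t).differentiableAt

/-- The derivatives of the trajectory are the columns of `e^{tA} C^r(A,b)`, whose compound factors.
-/
theorem wronskian_exp_smul_mulVec {n r : ℕ} (A : Matrix (Fin n) (Fin n) ℝ) (b : Fin n → ℝ)
    (I : Fin r ↪o Fin n) (t : ℝ) :
    wronskian (fun a t => (NormedSpace.exp (t • A)).mulVec b (I a)) t =
      (NormedSpace.exp (t • addCompound A r)).mulVec
        (fun J => multCompound (conMat r A b) r J (RelEmbedding.refl _)) I := by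
  have h : wronskian (fun a t => (NormedSpace.exp (t • A)).mulVec b (I a)) t =
      multCompound (NormedSpace.exp (t • A) * conMat r A b) r I (RelEmbedding.refl _) := by
    simp only [wronskian, multCompound, iteratedDeriv_exp_smul_mulVec]
    rfl
  rw [h, multCompound_mul, multCompound_exp]
  rfl

/-- Minors of the sampled controllability matrix are nonnegative for every sampling period. -/
theorem multCompound_conMat_exp_nonneg {n k : ℕ} {A : Matrix (Fin n) (Fin n) ℝ} {b : Fin n → ℝ}
    (hA : ∀ j : ℕ, 1 ≤ j → j ≤ k → IsMetzler (addCompound A j))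
    (hb : ∀ j : ℕ, 1 ≤ j → j ≤ k → EntrywiseNonneg (multCompound (conMat j A b) j))
    {j : ℕ} (hj : j ≤ k) {h : ℝ} (hh : 0 < h) :
    EntrywiseNonneg (multCompound (conMat j (NormedSpace.exp (h • A)) b) j) := by
  classical
  intro I K
  rw [K.fin_eq_refl]
  set f : Fin j → ℝ → ℝ := fun a t => (NormedSpace.exp (t • A)).mulVec b (I a) with hf
  have hfs : ∀ a, ContDiff ℝ ∞ (f a) := fun a => contDiff_exp_smul_mulVec A b (I a)
  -- The dichotomy holds only for `t > 0`, whereas the first sample is at time `0`; all samples are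
  -- shifted by `s`, and then `s → 0+`.
  have hpos : ∀ s : ℝ, 0 < s → 0 ≤ (Matrix.of fun a l : Fin j => f a (s + l * h)).det := by
    intro s hs
    refine det_values_nonneg_of_wronskian (t := fun l : Fin j => s + l * h) isOpen_Ioi
      (Set.ordConnected_Ioi (a := (0 : ℝ))) (fun a => (hfs a).contDiffOn) (fun q hq hq0 => ?_)
      (fun l => ?_) fun l m hlm => ?_
    · have hW := wronskian_exp_smul_mulVec A b ((Fin.castLEOrderEmb hq).trans I)
      refine ((hA q hq0 (hq.trans hj)).exp_mulVec_pos_or_eq_zero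
        (fun J => hb q hq0 (hq.trans hj) J (RelEmbedding.refl _))
        ((Fin.castLEOrderEmb hq).trans I)).imp (fun H t ht => ?_) fun H t _ => ?_
      · exact (H t ht).trans_eq (hW t).symm
      · exact (hW t).trans (H t)
    · exact add_pos_of_pos_of_nonneg hs (by positivity)
    · have : ((l : ℕ) : ℝ) < (m : ℕ) := by exact_mod_cast hlm
      dsimp only
      gcongr
  have hcont : Continuous fun s : ℝ => (Matrix.of fun a l : Fin j => f a (s + l * h)).det := by
    refine Continuous.matrix_det (continuous_matrix fun a l => ?_)
    exact (hfs a).continuous.comp (by fun_prop)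
  have hlim := (hcont.tendsto 0).mono_left (nhdsWithin_le_nhds (s := Set.Ioi 0))
  have h0 := ge_of_tendsto hlim (Filter.eventually_of_mem self_mem_nhdsWithin hpos)
  refine h0.trans_eq (congrArg Matrix.det ?_)
  ext a l
  simp [conMat, hf, exp_smul_pow]

/-! ### The limit of small sampling periods, and duality -/

/-- By the binomial theorem the two controllability matrices differ by a unipotent upper triangular
right factor. -/
theorem multCompound_conMat_add_one {n j : ℕ} (Y : Matrix (Fin n) (Fin n) ℝ) (b : Fin n → ℝ)
    (I : Fin j ↪o Fin n) :
    multCompound (conMat j (Y + 1) b) j I (RelEmbedding.refl _) =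
      multCompound (conMat j Y b) j I (RelEmbedding.refl _) := by
  set T : Matrix (Fin j) (Fin j) ℝ := Matrix.of fun m l => ((l : ℕ).choose m : ℝ) with hT
  have hTdet : T.det = 1 := by
    rw [Matrix.det_of_isUpperTriangular]
    · simp [hT]
    · intro i l hil
      simp only [hT, Matrix.of_apply]
      rw [Nat.choose_eq_zero_of_lt (by exact_mod_cast hil), Nat.cast_zero]
  have h : conMat j (Y + 1) b = conMat j Y b * T := by
    ext i l
    rw [Matrix.mul_apply]
    simp only [conMat, hT, Matrix.of_apply]
    rw [Fin.sum_univ_eq_sum_range (fun m => (Y ^ m).mulVec b i * ((l : ℕ).choose m : ℝ)) j,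
      (Commute.one_right Y).add_pow,
      ← Finset.sum_subset (Finset.range_subset_range.2 (Nat.succ_le_of_lt l.isLt))]
    · rw [Matrix.sum_mulVec, Finset.sum_apply]
      refine Finset.sum_congr rfl fun m _ => ?_
      rw [one_pow, mul_one, ← nsmul_eq_mul', Matrix.smul_mulVec, Pi.smul_apply, nsmul_eq_mul,
        mul_comm]
    · intro m _ hm
      rw [Nat.choose_eq_zero_of_lt (by simpa using hm), Nat.cast_zero, mul_zero]
  have hs : (conMat j Y b * T).submatrix I (RelEmbedding.refl _ : Fin j ↪o Fin j) =
      (conMat j Y b).submatrix I (RelEmbedding.refl _ : Fin j ↪o Fin j) * T := rfl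
  rw [multCompound, Matrix.of_apply, h, hs, Matrix.det_mul, hTdet, mul_one]
  rfl

theorem multCompound_conMat_smul {n j : ℕ} (x : ℝ) (Y : Matrix (Fin n) (Fin n) ℝ) (b : Fin n → ℝ)
    (I : Fin j ↪o Fin n) :
    multCompound (conMat j (x • Y) b) j I (RelEmbedding.refl _) =
      (∏ l : Fin j, x ^ (l : ℕ)) * multCompound (conMat j Y b) j I (RelEmbedding.refl _) := by
  simp only [multCompound, Matrix.of_apply]
  rw [← Matrix.det_mul_row]
  congr 1
  ext a l
  simp [conMat, smul_pow, Matrix.smul_mulVec]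

/-- Nonnegativity of the minors of the sampled controllability matrices for small sampling periods
passes to the limit. -/
theorem multCompound_conMat_nonneg_of_exp {n j : ℕ} {A : Matrix (Fin n) (Fin n) ℝ} {b : Fin n → ℝ}
    {ε : ℝ} (hε : 0 < ε) (H : ∀ h : ℝ, h ∈ Set.Ioo 0 ε →
      EntrywiseNonneg (multCompound (conMat j (NormedSpace.exp (h • A)) b) j)) :
    EntrywiseNonneg (multCompound (conMat j A b) j) := by
  intro I K
  rw [K.fin_eq_refl]
  have hlimA : Filter.Tendsto (fun h : ℝ => h⁻¹ • (NormedSpace.exp (h • A) - 1))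
      (nhdsWithin 0 (Set.Ioi 0)) (nhds A) := by
    refine tendsto_pi_nhds.2 fun i => tendsto_pi_nhds.2 fun l => ?_
    have := (hasDerivAt_exp_smul_apply A 0 i l).tendsto_slope_zero_right
    simpa using this
  have hcont : Continuous fun Y : Matrix (Fin n) (Fin n) ℝ =>
      multCompound (conMat j Y b) j I (RelEmbedding.refl _) := by
    simp only [multCompound, Matrix.of_apply]
    refine Continuous.matrix_det (continuous_matrix fun a l => ?_)
    exact (continuous_apply (I a)).comp ((continuous_pow (l : ℕ)).matrix_mulVec continuous_const)
  refine ge_of_tendsto ((hcont.tendsto A).comp hlimA) ?_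
  filter_upwards [Ioo_mem_nhdsGT hε] with h hh
  rw [Function.comp_apply, multCompound_conMat_smul]
  refine mul_nonneg (Finset.prod_nonneg fun l _ => pow_nonneg (inv_nonneg.2 hh.1.le) _) ?_
  rw [← multCompound_conMat_add_one, sub_add_cancel]
  exact H h hh I _

theorem multCompound_conMat_nonneg_iff {n k : ℕ} {A : Matrix (Fin n) (Fin n) ℝ} (b : Fin n → ℝ)
    (hA : ∀ j : ℕ, 1 ≤ j → j ≤ k → IsMetzler (addCompound A j)) :
    (∀ j : ℕ, 1 ≤ j → j ≤ k → EntrywiseNonneg (multCompound (conMat j A b) j)) ↔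
      ∃ ε : ℝ, 0 < ε ∧ ∀ j : ℕ, 1 ≤ j → j ≤ k → ∀ h : ℝ, h ∈ Set.Ioo 0 ε →
        EntrywiseNonneg (multCompound (conMat j (NormedSpace.exp (h • A)) b) j) :=
  ⟨fun hb => ⟨1, one_pos, fun _ _ hj _ hh => multCompound_conMat_exp_nonneg hA hb hj hh.1⟩,
    fun ⟨_, hε, H⟩ j hj1 hj => multCompound_conMat_nonneg_of_exp hε (H j hj1 hj)⟩

theorem entrywiseNonneg_multCompound_transpose {n m : ℕ} (X : Matrix (Fin n) (Fin m) ℝ) (r : ℕ) :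
    EntrywiseNonneg (multCompound X.transpose r) ↔ EntrywiseNonneg (multCompound X r) := by
  rw [multCompound_transpose]
  exact forall_comm

end

theorem mainTheorem6 (n k : ℕ) (A : Matrix (Fin n) (Fin n) ℝ) (b c : Fin n → ℝ)
    (hA : ∀ j : ℕ, 1 ≤ j → j ≤ k → IsMetzler (addCompound A j)) :
    ((∀ j : ℕ, 1 ≤ j → j ≤ k → EntrywiseNonneg (multCompound (conMat j A b) j)) ↔
      ∃ ε : ℝ, 0 < ε ∧ ∀ j : ℕ, 1 ≤ j → j ≤ k → ∀ h : ℝ, h ∈ Set.Ioo 0 ε →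
        EntrywiseNonneg (multCompound (conMat j (NormedSpace.exp (h • A)) b) j)) ∧
    ((∀ j : ℕ, 1 ≤ j → j ≤ k → EntrywiseNonneg (multCompound (obsMat j A c) j)) ↔
      ∃ ε : ℝ, 0 < ε ∧ ∀ j : ℕ, 1 ≤ j → j ≤ k → ∀ h : ℝ, h ∈ Set.Ioo 0 ε →
        EntrywiseNonneg (multCompound (obsMat j (NormedSpace.exp (h • A)) c) j)) := by
  refine ⟨multCompound_conMat_nonneg_iff b hA, ?_⟩
  have hAt : ∀ j : ℕ, 1 ≤ j → j ≤ k → IsMetzler (addCompound A.transpose j) := by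
    intro j hj1 hj I J hIJ
    rw [addCompound_transpose]
    exact hA j hj1 hj J I hIJ.symm
  simp only [obsMat, entrywiseNonneg_multCompound_transpose, ← Matrix.exp_transpose,
    Matrix.transpose_smul]
  exact multCompound_conMat_nonneg_iff c hAt
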